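/- Let $G$ be a finitely generated, residually torsion-free nilpotent group, i.e. every non-identity element of $G$ has nontrivial image in some torsion-free nilpotent quotient of $G$. Let $LO(G)$ be the space of left-invariant total orderings of $G$, topologized as a subspace of $\{0,1\}^G$ (product topology) by identifying an ordering $\le$ with its positive cone $\{g\in G : 1<g\}$. For $\phi\in\operatorname{Aut}(G)$ and $\le$ in $LO(G)$, let $\le_\phi$ be the pulled-back ordering, $g\le_\phi h$ if and only if $\phi(g)\le\phi(h)$; then $\le\,\mapsto\,\le_\phi$ is a homeomorphism $\psi_a(\phi)$ of $LO(G)$. The map $$\psi_a:\operatorname{Aut}(G)\to\operatorname{Homeo}(LO(G)),\qquad \phi\mapsto(\le\,\mapsto\,\le_\phi),$$ is injective. In particular, for every nontrivial $\phi\in\operatorname{Aut}(G)$ there is a left-invariant ordering $\le$ of $G$ with $\le_\phi\;\neq\;\le$. -/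

import Mathlib

/-- A left-invariant (total) ordering on a group `G`. -/
@[ext]
structure LeftOrdering (G : Type*) [Group G] where
  /-- The order relation. -/
  le : G → G → Prop
  refl : ∀ a, le a a
  antisymm : ∀ a b, le a b → le b a → a = b
  trans : ∀ a b c, le a b → le b c → le a c
  total : ∀ a b, le a b ∨ le b a
  mul_left : ∀ a b c, le a b → le (c * a) (c * b)

namespace LeftOrdering

variable {G : Type*} [Group G]

/-- The positive cone `{g | 1 < g}` of a left-invariant ordering. -/
def positiveCone (o : LeftOrdering G) : Set G := {g | o.le 1 g ∧ g ≠ 1}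

open Classical in
/-- The indicator function of the positive cone, a point of `{0,1}^G`. -/
noncomputable def coneIndicator (o : LeftOrdering G) : G → Bool :=
  fun g => decide (g ∈ o.positiveCone)

/-- The topology on the space of left-invariant orderings: the subspace topology coming from the
identification of orderings with their positive cones, as points of `{0,1}^G` with the product
topology (`Bool` is discrete). -/
noncomputable instance : TopologicalSpace (LeftOrdering G) :=
  TopologicalSpace.induced coneIndicator inferInstance

/-- The pull-back of an ordering by an automorphism: `g ≤_φ h` iff `φ g ≤ φ h`. -/
def pullback (φ : MulAut G) (o : LeftOrdering G) : LeftOrdering G where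
  le g h := o.le (φ g) (φ h)
  refl _ := o.refl _
  antisymm _ _ h₁ h₂ := φ.injective (o.antisymm _ _ h₁ h₂)
  trans _ _ _ := o.trans _ _ _
  total _ _ := o.total _ _
  mul_left a b c h := by
    simpa only [map_mul] using o.mul_left (φ a) (φ b) (φ c) h

theorem coneIndicator_injective :
    Function.Injective (coneIndicator : LeftOrdering G → G → Bool) := by
  intro o o' h
  have key : ∀ g, o.le 1 g ↔ o'.le 1 g := by
    intro g
    by_cases hg : g = 1
    · subst hg
      exact iff_of_true (o.refl 1) (o'.refl 1)
    · have := congrFun h g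
      simp only [coneIndicator, decide_eq_decide] at this
      simpa [positiveCone, hg] using this
  have tr : ∀ (p : LeftOrdering G) (a b : G), p.le a b ↔ p.le 1 (a⁻¹ * b) := by
    intro p a b
    constructor
    · intro hab
      simpa using p.mul_left a b a⁻¹ hab
    · intro hab
      simpa using p.mul_left 1 (a⁻¹ * b) a hab
  ext a b
  rw [tr o, tr o', key]

theorem coneIndicator_pullback (φ : MulAut G) (o : LeftOrdering G) (g : G) :
    (o.pullback φ).coneIndicator g = o.coneIndicator (φ g) := by
  simp only [coneIndicator, decide_eq_decide]
  simp [positiveCone, pullback]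

theorem continuous_pullback (φ : MulAut G) :
    Continuous (pullback φ : LeftOrdering G → LeftOrdering G) := by
  refine continuous_induced_rng.2 (continuous_pi fun g => ?_)
  have h : Continuous fun o : LeftOrdering G => o.coneIndicator (φ g) :=
    (continuous_apply (A := fun _ : G => Bool) (φ g)).comp
      (continuous_induced_dom (f := coneIndicator))
  simpa only [Function.comp_def, coneIndicator_pullback] using h

/-- The map `ψ_a : Aut(G) → Homeo(LO(G))` sending `φ` to the homeomorphism `≤ ↦ ≤_φ`. -/
def psiA (φ : MulAut G) : LeftOrdering G ≃ₜ LeftOrdering G where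
  toFun := pullback φ
  invFun := pullback φ⁻¹
  left_inv o := by
    ext a b
    simp [pullback]
  right_inv o := by
    ext a b
    simp [pullback]
  continuous_toFun := continuous_pullback φ
  continuous_invFun := continuous_pullback φ⁻¹

/-- Pulling back is a (right) action of `Aut(G)`. -/
theorem psiA_mul (φ ψ : MulAut G) (o : LeftOrdering G) :
    psiA (φ * ψ) o = psiA ψ (psiA φ o) := rfl

end LeftOrdering

/-- A group is residually torsion-free nilpotent if every non-identity element survives in some
torsion-free nilpotent quotient. -/
def IsResiduallyTorsionFreeNilpotent (G : Type*) [Group G] : Prop :=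
  ∀ g : G, g ≠ 1 → ∃ (N : Subgroup G) (_ : N.Normal),
    Group.IsNilpotent (G ⧸ N) ∧ (∀ x : G ⧸ N, x ≠ 1 → ¬ IsOfFinOrder x) ∧ (g : G ⧸ N) ≠ 1

/-! Suppose `φ` fixes every left-invariant ordering. Then `g` and `φ g` share a positive power,
since otherwise some ordering has `φ g < 1 < g` (`exists_mem_positiveCone_inv_mem`). Hence `φ`
preserves the sign of each character `χ : G → ℤ`, so `χ ∘ φ` is a positive multiple of `χ` with the
same image, that is, `χ` itself (`character_apply_of_pow_eq`). Take `χ` nonzero: if `χ g ≠ 0`, the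
exponents in `g ^ m = φ g ^ n` agree, and unique roots give `φ g = g`. Elements outside `ker χ`
generate `G`.

The ordering comes from a Burns–Hale argument: every nontrivial finitely generated subgroup needs a
nonzero character that is `≥ 0` at `g` and `≤ 0` at `h`. Two independent characters combine to one
killing `g`; if there are none, the subgroup is infinite cyclic and opposite signs are possible
unless `g` and `h` share a positive power. -/

/-! ### Unique roots in torsion-free nilpotent groups. -/

open Subgroup in
theorem mem_center_of_pow_mem_center_of_conj {G : Type*} [Group G]
    (h : ∀ z ∈ center G, ∀ n : ℕ, n ≠ 0 → z ^ n = 1 → z = 1) {x : G}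
    (hx : ∀ y, y * x * y⁻¹ * x⁻¹ ∈ center G) {n : ℕ} (hn : n ≠ 0) (hxn : x ^ n ∈ center G) :
    x ∈ center G := by
  rw [mem_center_iff]
  intro y
  set c := y * x * y⁻¹ * x⁻¹ with hc
  have h1 : y * x * y⁻¹ = c * x := by simp [hc]
  have h2 : (y * x * y⁻¹) ^ n = x ^ n := by
    rw [conj_pow, mem_center_iff.1 hxn y, mul_inv_cancel_right]
  have hcomm : Commute c x := (mem_center_iff.1 (hx y) x).symm
  rw [h1, hcomm.mul_pow] at h2
  have h3 : c = 1 := h c (hx y) n hn (by simpa using h2)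
  rw [h3, one_mul] at h1
  exact mul_inv_eq_iff_eq_mul.1 h1

-- Induction on the upper central series: by the previous lemma, a center without torsion passes
-- this property on to the center of `G ⧸ center G`.
open Subgroup in
theorem isMulTorsionFree_of_center (G : Type*) [Group G] [Group.IsNilpotent G]
    (h : ∀ z ∈ center G, ∀ n : ℕ, n ≠ 0 → z ^ n = 1 → z = 1) : IsMulTorsionFree G := by
  revert h
  apply @Group.nilpotent_center_quotient_ind _ G _ _ <;> clear! G
  · intro G _ _ _
    exact ⟨fun n _ x y _ => Subsingleton.elim x y⟩
  · intro G _ _ ih h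
    have hQ : IsMulTorsionFree (G ⧸ center G) := by
      refine ih fun z hz n hn hzn => ?_
      obtain ⟨x, rfl⟩ := QuotientGroup.mk_surjective z
      rw [← QuotientGroup.mk_pow, QuotientGroup.eq_one_iff] at hzn
      rw [QuotientGroup.eq_one_iff]
      refine mem_center_of_pow_mem_center_of_conj h (fun y => ?_) hn hzn
      rw [← QuotientGroup.eq_one_iff]
      have := mem_center_iff.1 hz (y : G ⧸ center G)
      simp [this]
    refine ⟨fun n hn x y hxy => ?_⟩
    have hq : (x : G ⧸ center G) = y :=
      pow_left_injective hn (by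
        simpa using congrArg (QuotientGroup.mk : G → G ⧸ center G) hxy)
    rw [QuotientGroup.eq] at hq
    have hcomm : Commute x (x⁻¹ * y) := mem_center_iff.1 hq x
    have hy : y = x * (x⁻¹ * y) := by simp
    have hxy' : x ^ n = (x * (x⁻¹ * y)) ^ n := by rw [← hy]; exact hxy
    rw [hcomm.mul_pow] at hxy'
    exact (inv_mul_eq_one.1 (h _ hq n hn (by simpa using hxy')))

theorem isMulTorsionFree_of_forall_not_isOfFinOrder (G : Type*) [Group G] [Group.IsNilpotent G]
    (h : ∀ x : G, x ≠ 1 → ¬ IsOfFinOrder x) : IsMulTorsionFree G :=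
  isMulTorsionFree_of_center G fun z _ n hn hz => by
    by_contra hz1
    exact h z hz1 (isOfFinOrder_iff_pow_eq_one.2 ⟨n, Nat.pos_of_ne_zero hn, hz⟩)

open Subgroup in
theorem isMulTorsionFree_quotient_center (G : Type*) [Group G] [Group.IsNilpotent G]
    [IsMulTorsionFree G] : IsMulTorsionFree (G ⧸ center G) := by
  refine isMulTorsionFree_of_forall_not_isOfFinOrder _ fun x hx hfin => hx ?_
  obtain ⟨n, hn, hxn⟩ := isOfFinOrder_iff_pow_eq_one.1 hfin
  obtain ⟨x, rfl⟩ := QuotientGroup.mk_surjective x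
  rw [← QuotientGroup.mk_pow, QuotientGroup.eq_one_iff] at hxn
  rw [QuotientGroup.eq_one_iff, mem_center_iff]
  intro y
  have h2 : (y * x * y⁻¹) ^ n = x ^ n := by
    rw [conj_pow, mem_center_iff.1 hxn y, mul_inv_cancel_right]
  exact mul_inv_eq_iff_eq_mul.1 (pow_left_injective hn.ne' h2)

/-! ### Groups with at most one independent character are cyclic. -/

/-- Any two integral characters of `E` are linearly dependent. -/
def CharactersDependent (E : Type*) [Group E] : Prop :=
  ∀ (χ ψ : E →* Multiplicative ℤ) (x y : E),
    (χ x).toAdd * (ψ y).toAdd = (χ y).toAdd * (ψ x).toAdd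

theorem CharactersDependent.of_surjective {E F : Type*} [Group E] [Group F]
    (h : CharactersDependent E) (f : E →* F) (hf : Function.Surjective f) :
    CharactersDependent F := by
  intro χ ψ x y
  obtain ⟨x, rfl⟩ := hf x
  obtain ⟨y, rfl⟩ := hf y
  exact h (χ.comp f) (ψ.comp f) x y

theorem CharactersDependent.isCyclic_of_comm {E : Type*} [CommGroup E] [Group.FG E]
    [IsMulTorsionFree E] (h : CharactersDependent E) : IsCyclic E := by
  have : Module.Finite ℤ (Additive E) := Module.Finite.iff_addGroup_fg.2 inferInstance
  let b := Module.Free.chooseBasis ℤ (Additive E)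
  have hsub : ∀ i j : Module.Free.ChooseBasisIndex ℤ (Additive E), i = j := by
    intro i j
    by_contra hij
    -- Coordinates along two distinct basis vectors would be independent characters.
    have := h (AddMonoidHom.toMultiplicativeRight (b.coord i).toAddMonoidHom)
      (AddMonoidHom.toMultiplicativeRight (b.coord j).toAddMonoidHom) (b i).toMul (b j).toMul
    simp [hij, Ne.symm hij] at this
  rw [← isAddCyclic_additive_iff]
  rcases isEmpty_or_nonempty (Module.Free.ChooseBasisIndex ℤ (Additive E)) with hι | ⟨⟨i⟩⟩
  · refine ⟨⟨0, fun x => ?_⟩⟩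
    have : x = 0 := by rw [← b.sum_repr x]; simp
    simp [this]
  · refine ⟨⟨b i, fun x => ⟨b.repr x i, ?_⟩⟩⟩
    have : Finset.univ = {i} := by ext j; simp [hsub j i]
    conv_rhs => rw [← b.sum_repr x, this, Finset.sum_singleton]

/-- A group that is cyclic modulo its center is abelian, so induction reduces to the free abelian
case. -/
theorem CharactersDependent.isCyclic_of_isNilpotent (E : Type*) [Group E] [Group.IsNilpotent E] :
    ∀ [Group.FG E] [IsMulTorsionFree E], CharactersDependent E → IsCyclic E := by
  apply @Group.nilpotent_center_quotient_ind _ E _ _ <;> clear! E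
  · intro G _ _ _ _ _
    infer_instance
  · intro G _ _ ih _ _ h
    have := isMulTorsionFree_quotient_center G
    have hc : IsCyclic (G ⧸ Subgroup.center G) :=
      ih (h.of_surjective _ (QuotientGroup.mk'_surjective _))
    have hcomm := (QuotientGroup.mk' (Subgroup.center G)).isMulCommutative_of_isCyclic_of_ker_le_center
      (by simp)
    let : CommGroup G := { ‹Group G› with mul_comm := hcomm.is_comm.comm }
    exact h.isCyclic_of_comm

/-- `G` is separated by homomorphisms to nilpotent groups with unique roots. -/
def ResiduallyNilpotentUniqueRoots.{u} (G : Type u) [Group G] : Prop :=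
  ∀ g : G, g ≠ 1 → ∃ (Q : Type u) (_ : Group Q) (_ : Group.IsNilpotent Q) (_ : IsMulTorsionFree Q)
    (f : G →* Q), f g ≠ 1

theorem IsResiduallyTorsionFreeNilpotent.residuallyNilpotentUniqueRoots {G : Type*} [Group G]
    (hG : IsResiduallyTorsionFreeNilpotent G) : ResiduallyNilpotentUniqueRoots G := by
  intro g hg
  obtain ⟨N, hN, hnil, htf, hgN⟩ := hG g hg
  exact ⟨G ⧸ N, inferInstance, hnil, isMulTorsionFree_of_forall_not_isOfFinOrder _ htf,
    QuotientGroup.mk' N, hgN⟩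

namespace ResiduallyNilpotentUniqueRoots

theorem subgroup {G : Type*} [Group G] (hG : ResiduallyNilpotentUniqueRoots G) (E : Subgroup G) :
    ResiduallyNilpotentUniqueRoots E := by
  intro g hg
  obtain ⟨Q, _, h1, h2, f, hf⟩ := hG g (by simpa using hg)
  exact ⟨Q, _, h1, h2, f.comp E.subtype, hf⟩

theorem isMulTorsionFree {G : Type*} [Group G] (hG : ResiduallyNilpotentUniqueRoots G) :
    IsMulTorsionFree G := by
  refine ⟨fun n hn x y hxy => ?_⟩
  by_contra hne
  obtain ⟨Q, _, h1, h2, f, hf⟩ := hG (x⁻¹ * y) (fun h => hne (inv_mul_eq_one.1 h))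
  apply hf
  have : f x = f y := pow_left_injective hn (by simpa using congrArg f hxy)
  simp [this]

/-- A nontrivial commutator would survive in a nilpotent image that inherits dependence of
characters and is therefore cyclic. -/
theorem isCyclic {E : Type*} [Group E] [Group.FG E] (hE : ResiduallyNilpotentUniqueRoots E)
    (h : CharactersDependent E) : IsCyclic E := by
  have hcomm : ∀ x y : E, x * y = y * x := by
    intro x y
    by_contra hne
    obtain ⟨Q, _, h1, h2, f, hf⟩ := hE ((x * y)⁻¹ * (y * x)) (fun h => hne (inv_mul_eq_one.1 h))
    have : IsMulTorsionFree f.range :=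
      ⟨fun n hn a b hab => Subtype.ext (pow_left_injective hn (by
        simpa using congrArg Subtype.val hab))⟩
    have hc : IsCyclic f.range := CharactersDependent.isCyclic_of_isNilpotent f.range
      (h.of_surjective _ f.rangeRestrict_surjective)
    let := hc.commGroup
    apply hf
    have := congrArg Subtype.val (mul_comm (f.rangeRestrict x) (f.rangeRestrict y))
    have : f x * f y = f y * f x := by simpa using this
    simp only [map_mul, map_inv, this, inv_mul_cancel]
  have := hE.isMulTorsionFree
  let : CommGroup E := { ‹Group E› with mul_comm := hcomm }
  exact h.isCyclic_of_comm

end ResiduallyNilpotentUniqueRoots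

/-- If two characters are independent, then every element is killed by a nonzero character. -/
theorem exists_character_of_not_dependent {E : Type*} [Group E] (h : ¬ CharactersDependent E)
    (g : E) : ∃ χ : E →* Multiplicative ℤ, χ ≠ 1 ∧ χ g = 1 := by
  simp only [CharactersDependent, not_forall] at h
  obtain ⟨χ, ψ, x, y, hne⟩ := h
  by_cases hg : χ g = 1 ∧ ψ g = 1
  · refine ⟨χ, ?_, hg.1⟩
    rintro rfl
    simp at hne
  -- Additively `ψ(g) χ - χ(g) ψ`, which vanishes at `g`.
  · refine ⟨χ ^ (ψ g).toAdd * ψ ^ (-(χ g).toAdd), fun h0 => hg ?_, ?_⟩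
    · have hx := congrArg Multiplicative.toAdd (DFunLike.congr_fun h0 x)
      have hy := congrArg Multiplicative.toAdd (DFunLike.congr_fun h0 y)
      simp only [MonoidHom.mul_apply, MonoidHom.zpow_apply, toAdd_mul, toAdd_zpow,
        MonoidHom.one_apply, toAdd_one, smul_eq_mul] at hx hy
      have hd := sub_ne_zero.2 hne
      constructor
      · apply Multiplicative.toAdd.injective
        refine (mul_eq_zero.1 (?_ : (χ g).toAdd * _ = 0)).resolve_right hd
        linear_combination (χ x).toAdd * hy * (-1) + (χ y).toAdd * hx
      · apply Multiplicative.toAdd.injective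
        refine (mul_eq_zero.1 (?_ : (ψ g).toAdd * _ = 0)).resolve_right hd
        linear_combination (ψ y).toAdd * hx - (ψ x).toAdd * hy
    · apply Multiplicative.toAdd.injective
      simp only [MonoidHom.mul_apply, MonoidHom.zpow_apply, toAdd_mul, toAdd_zpow, toAdd_one,
        smul_eq_mul]
      ring

theorem exists_character_generator {E : Type*} [Group E] [Nontrivial E] [IsMulTorsionFree E]
    (hE : IsCyclic E) : ∃ (χ : E →* Multiplicative ℤ) (t : E), χ ≠ 1 ∧
      ∀ x, x = t ^ (χ x).toAdd := by
  obtain ⟨x, hx⟩ := exists_ne (1 : E)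
  have hfin : ¬ IsOfFinOrder x := fun h => by
    obtain ⟨n, hn, hxn⟩ := isOfFinOrder_iff_pow_eq_one.1 h
    exact hx (pow_left_injective hn.ne' (by simpa using hxn))
  have : Infinite E := Infinite.of_injective _ (injective_pow_iff_not_isOfFinOrder.2 hfin)
  let e : Multiplicative ℤ ≃* E := intCyclicMulEquiv
  refine ⟨e.symm.toMonoidHom, e (.ofAdd 1), fun h => hx ?_, fun y => ?_⟩
  · exact (MulEquiv.map_eq_one_iff e.symm).1 (DFunLike.congr_fun h x)
  · rw [← map_zpow, ← ofAdd_zsmul, smul_eq_mul, mul_one, ofAdd_toAdd]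
    simp

/-- Sign conditions on a pair of elements can be met by a nonzero character. -/
theorem ResiduallyNilpotentUniqueRoots.exists_character {E : Type*} [Group E] [Group.FG E]
    [Nontrivial E] (hE : ResiduallyNilpotentUniqueRoots E) (g h : E)
    (hgh : ∀ m n : ℕ, m ≠ 0 → n ≠ 0 → g ^ m ≠ h ^ n) :
    ∃ χ : E →* Multiplicative ℤ, χ ≠ 1 ∧ 0 ≤ (χ g).toAdd ∧ (χ h).toAdd ≤ 0 := by
  suffices H : ∃ χ : E →* Multiplicative ℤ, χ ≠ 1 ∧ (χ g).toAdd * (χ h).toAdd ≤ 0 by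
    obtain ⟨χ, h1, h2⟩ := H
    rcases mul_nonpos_iff.1 h2 with h3 | h3
    · exact ⟨χ, h1, h3⟩
    · exact ⟨χ⁻¹, by simpa using h1, by simpa using h3⟩
  by_cases hd : CharactersDependent E
  · have := hE.isMulTorsionFree
    obtain ⟨χ, t, h1, ht⟩ := exists_character_generator (hE.isCyclic hd)
    refine ⟨χ, h1, not_lt.1 fun hpos => ?_⟩
    have ha : (χ g).toAdd ≠ 0 := fun h0 => by simp [h0] at hpos
    have hb : (χ h).toAdd ≠ 0 := fun h0 => by simp [h0] at hpos
    -- With `g = t ^ a`, `h = t ^ b` and `a * b > 0`, one has `g ^ |b| = h ^ |a|`.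
    apply hgh (χ h).toAdd.natAbs (χ g).toAdd.natAbs (by simpa using hb) (by simpa using ha)
    rw [← zpow_natCast, ← zpow_natCast]
    nth_rewrite 1 [ht g]
    nth_rewrite 2 [ht h]
    rw [← zpow_mul, ← zpow_mul]
    congr 1
    rw [Int.natCast_natAbs, Int.natCast_natAbs]
    rcases pos_and_pos_or_neg_and_neg_of_mul_pos hpos with ⟨h1, h2⟩ | ⟨h1, h2⟩
    · rw [abs_of_pos h1, abs_of_pos h2, mul_comm]
    · rw [abs_of_neg h1, abs_of_neg h2]; ring
  · obtain ⟨χ, h1, h2⟩ := exists_character_of_not_dependent hd g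
    exact ⟨χ, h1, by simp [h2]⟩

/-! ### Orderings built from characters of finitely generated subgroups. -/

namespace LeftOrdering

variable {G : Type*} [Group G]

/-- The left-invariant ordering with a given positive cone. -/
def ofCone (P : Set G) (hmul : ∀ x ∈ P, ∀ y ∈ P, x * y ∈ P) (hone : (1 : G) ∉ P)
    (htot : ∀ x, x ≠ 1 → x ∈ P ∨ x⁻¹ ∈ P) : LeftOrdering G where
  le a b := a = b ∨ a⁻¹ * b ∈ P
  refl _ := Or.inl rfl
  antisymm a b := by
    rintro (h | h) (h' | h')
    · exact h
    · exact h
    · exact h'.symm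
    · exact absurd (by simpa [mul_assoc] using hmul _ h _ h') hone
  trans a b c := by
    rintro (rfl | h) (rfl | h')
    · exact Or.inl rfl
    · exact Or.inr h'
    · exact Or.inr h
    · exact Or.inr (by simpa [mul_assoc] using hmul _ h _ h')
  total a b := by
    by_cases hab : a = b
    · exact Or.inl (Or.inl hab)
    · rcases htot (a⁻¹ * b) (fun h => hab (inv_mul_eq_one.1 h)) with h | h
      · exact Or.inl (Or.inr h)
      · exact Or.inr (Or.inr (by simpa using h))
  mul_left a b c := by
    rintro (rfl | h)
    · exact Or.inl rfl
    · exact Or.inr (by simpa [mul_assoc] using h)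

/-- A finite set of elements can be signed, compatibly with `T`, inside a subsemigroup
avoiding `1`, if finitely generated subgroups have characters nonnegative on `T`. -/
theorem exists_partial_cone (T : Set G)
    (hT : ∀ E : Subgroup G, E.FG → E ≠ ⊥ → ∃ χ : E →* Multiplicative ℤ, χ ≠ 1 ∧
      ∀ t : E, (t : G) ∈ T → 0 ≤ (χ t).toAdd) (F : Finset G) :
    ∃ P : Set G, (∀ x ∈ P, ∀ y ∈ P, x * y ∈ P) ∧ 1 ∉ P ∧
      ∀ x ∈ F, x ≠ 1 → (x ∈ P ∨ x⁻¹ ∈ P) ∧ (x ∈ T → x ∈ P) := by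
  classical
  induction F using Finset.strongInduction with
  | H F ih =>
  set E := Subgroup.closure (F : Set G) with hEdef
  have hFE : ∀ x ∈ F, x ∈ E := fun x hx => Subgroup.subset_closure hx
  by_cases hE : E = ⊥
  · refine ⟨∅, by simp, by simp, fun x hx hx1 => absurd ?_ hx1⟩
    simpa [hE] using hFE x hx
  obtain ⟨χ, hχ, hχT⟩ := hT E ⟨F, rfl⟩ hE
  let K : Subgroup G := χ.ker.map E.subtype
  have hmemK : ∀ x : E, (x : G) ∈ K ↔ χ x = 1 := fun x => by
    simp [K, MonoidHom.mem_ker]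
  -- As `χ ≠ 1`, some generator in `F` lies outside the kernel, so the induction descends.
  have hlt : F.filter (· ∈ K) ⊂ F := by
    refine Finset.filter_ssubset.2 ?_
    by_contra! hall
    apply hχ
    have hle : E ≤ K := (Subgroup.closure_le K).2 hall
    ext x
    exact congrArg Multiplicative.toAdd ((hmemK x).1 (hle x.2))
  obtain ⟨P₀, hmul, hone, hP⟩ := ih _ hlt
  -- Lexicographic cone: the sign of `χ` decides, and `P₀` breaks ties on the kernel.
  let P : Set G := {x | (∃ e : E, (e : G) = x ∧ 0 < (χ e).toAdd) ∨ (x ∈ K ∧ x ∈ P₀)}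
  have hK : ∀ x ∈ K, ∃ e : E, (e : G) = x ∧ (χ e).toAdd = 0 := by
    rintro _ ⟨e, he, rfl⟩
    exact ⟨e, rfl, congrArg Multiplicative.toAdd (MonoidHom.mem_ker.1 he)⟩
  refine ⟨P, ?_, ?_, ?_⟩
  · rintro x (⟨e, rfl, he⟩ | ⟨hx, hx'⟩) y (⟨f, rfl, hf⟩ | ⟨hy, hy'⟩)
    · exact Or.inl ⟨e * f, rfl, by simpa using add_pos he hf⟩
    · obtain ⟨f, rfl, hf⟩ := hK y hy
      exact Or.inl ⟨e * f, rfl, by simpa [hf] using he⟩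
    · obtain ⟨e, rfl, he⟩ := hK x hx
      exact Or.inl ⟨e * f, rfl, by simpa [he] using hf⟩
    · exact Or.inr ⟨mul_mem hx hy, hmul x hx' y hy'⟩
  · rintro (⟨e, he, hpos⟩ | ⟨_, h1⟩)
    · obtain rfl : e = 1 := Subtype.ext he
      simp at hpos
    · exact hone h1
  · intro x hx hx1
    by_cases hxK : x ∈ K
    · obtain ⟨h1, h2⟩ := hP x (Finset.mem_filter.2 ⟨hx, hxK⟩) hx1
      exact ⟨h1.imp (fun h => Or.inr ⟨hxK, h⟩) fun h => Or.inr ⟨inv_mem hxK, h⟩,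
        fun h => Or.inr ⟨hxK, h2 h⟩⟩
    · let e : E := ⟨x, hFE x hx⟩
      have hne : (χ e).toAdd ≠ 0 := fun h0 =>
        hxK ((hmemK e).2 (Multiplicative.toAdd.injective h0))
      refine ⟨?_, fun hxT => Or.inl ⟨e, rfl, lt_of_le_of_ne (hχT e hxT) hne.symm⟩⟩
      rcases lt_or_gt_of_ne hne with h | h
      · exact Or.inr (Or.inl ⟨e⁻¹, rfl, by simpa using h⟩)
      · exact Or.inl (Or.inl ⟨e, rfl, h⟩)

/-- A Burns–Hale criterion with prescribed positive elements. -/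
theorem exists_forall_mem_positiveCone (T : Set G) (hT1 : 1 ∉ T)
    (hT : ∀ E : Subgroup G, E.FG → E ≠ ⊥ → ∃ χ : E →* Multiplicative ℤ, χ ≠ 1 ∧
      ∀ t : E, (t : G) ∈ T → 0 ≤ (χ t).toAdd) :
    ∃ o : LeftOrdering G, ∀ t ∈ T, t ∈ o.positiveCone := by
  classical
  choose P hmul hone hP using exists_partial_cone T hT
  -- Compactness: an ultrafilter limit of the partial cones is total, because each `x` eventually
  -- lies in `F`.
  let U : Ultrafilter (Finset G) := Ultrafilter.of Filter.atTop
  have hU : ∀ x : G, ∀ᶠ F in (U : Filter (Finset G)), x ∈ F := fun x =>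
    Ultrafilter.of_le _ ((Filter.eventually_ge_atTop ({x} : Finset G)).mono fun F hF =>
      Finset.singleton_subset_iff.1 hF)
  refine ⟨ofCone {x | ∀ᶠ F in (U : Filter (Finset G)), x ∈ P F} ?_ ?_ ?_, ?_⟩
  · intro x hx y hy
    filter_upwards [hx, hy] with F h1 h2 using hmul F x h1 y h2
  · intro h
    obtain ⟨F, hF⟩ := h.exists
    exact hone F hF
  · intro x hx
    exact Ultrafilter.eventually_or.1 ((hU x).mono fun F hF => (hP F x hF hx).1)
  · intro t ht
    have ht1 : t ≠ 1 := fun h => hT1 (h ▸ ht)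
    refine ⟨Or.inr ?_, ht1⟩
    simpa using (hU t).mono fun F hF => (hP F t hF ht1).2 ht

theorem exists_mem_positiveCone_inv_mem (hG : ResiduallyNilpotentUniqueRoots G) {g h : G}
    (hg : g ≠ 1) (hh : h ≠ 1) (hgh : ∀ m n : ℕ, m ≠ 0 → n ≠ 0 → g ^ m ≠ h ^ n) :
    ∃ o : LeftOrdering G, g ∈ o.positiveCone ∧ h⁻¹ ∈ o.positiveCone := by
  have := hG.isMulTorsionFree
  have key : ∀ E : Subgroup G, E.FG → E ≠ ⊥ → ∃ χ : E →* Multiplicative ℤ, χ ≠ 1 ∧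
      ∀ t : E, (t : G) ∈ ({g, h⁻¹} : Set G) → 0 ≤ (χ t).toAdd := by
    intro E hE hne
    have : Group.FG E := (Group.fg_iff_subgroup_fg E).2 hE
    have : Nontrivial E := (Subgroup.nontrivial_iff_ne_bot E).2 hne
    have hpow : ∀ x : E, x ≠ 1 → ∀ n : ℕ, n ≠ 0 → x ^ n ≠ 1 := fun x hx n hn h0 => by
      apply hx
      apply Subtype.ext
      apply pow_left_injective hn
      simpa using congrArg Subtype.val h0
    -- An element outside `E` imposes no condition and is replaced by `1`; if both are outside, one
    -- is replaced by some `x ≠ 1`, since the pair `1, 1` has common powers.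
    obtain ⟨a, b, ha, hb, hab⟩ : ∃ a b : E, (g ∈ E → (a : G) = g) ∧ (h ∈ E → (b : G) = h) ∧
        ∀ m n : ℕ, m ≠ 0 → n ≠ 0 → a ^ m ≠ b ^ n := by
      by_cases hgE : g ∈ E <;> by_cases hhE : h ∈ E
      · refine ⟨⟨g, hgE⟩, ⟨h, hhE⟩, fun _ => rfl, fun _ => rfl, fun m n hm hn h0 => ?_⟩
        exact hgh m n hm hn (by simpa using congrArg Subtype.val h0)
      · refine ⟨⟨g, hgE⟩, 1, fun _ => rfl, fun h => absurd h hhE, fun m n hm hn => ?_⟩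
        rw [one_pow]
        exact hpow _ (by simpa using hg) m hm
      · refine ⟨1, ⟨h, hhE⟩, fun h => absurd h hgE, fun _ => rfl, fun m n hm hn => ?_⟩
        rw [one_pow]
        exact (hpow _ (by simpa using hh) n hn).symm
      · obtain ⟨x, hx⟩ := exists_ne (1 : E)
        refine ⟨x, 1, fun h => absurd h hgE, fun h => absurd h hhE, fun m n hm hn => ?_⟩
        rw [one_pow]
        exact hpow _ hx m hm
    obtain ⟨χ, hχ, h1, h2⟩ := (hG.subgroup E).exists_character a b hab
    refine ⟨χ, hχ, fun t ht => ?_⟩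
    rcases ht with ht | ht
    · rwa [show t = a from Subtype.ext (ht.trans (ha (ht ▸ t.2)).symm)]
    · have hhE : h ∈ E := by
        rw [← inv_mem_iff, ← Set.mem_singleton_iff.1 ht]
        exact t.2
      have : t = b⁻¹ := Subtype.ext (by simp [hb hhE, Set.mem_singleton_iff.1 ht])
      simpa [this] using h2
  obtain ⟨o, ho⟩ := exists_forall_mem_positiveCone {g, h⁻¹} (by
    rintro (h1 | h1)
    · exact hg h1.symm
    · exact hh (inv_eq_one.1 (Set.mem_singleton_iff.1 h1).symm)) key
  exact ⟨o, ho _ (by simp), ho _ (by simp)⟩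

theorem exists_pow_eq_of_pullback_eq (hG : ResiduallyNilpotentUniqueRoots G) {φ : MulAut G}
    (hφ : ∀ o : LeftOrdering G, o.pullback φ = o) (g : G) :
    ∃ m n : ℕ, m ≠ 0 ∧ n ≠ 0 ∧ g ^ m = φ g ^ n := by
  by_cases hg : g = 1
  · exact ⟨1, 1, by simp [hg]⟩
  by_contra! hne
  obtain ⟨o, ⟨h1, -⟩, h2, -⟩ :=
    exists_mem_positiveCone_inv_mem hG hg (by simpa using hg : φ g ≠ 1) hne
  have h3 : o.le 1 (φ g) := by
    rw [← hφ o] at h1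
    simpa [pullback] using h1
  have h4 := o.mul_left _ _ (φ g) h2
  simp only [mul_one, mul_inv_cancel] at h4
  have := o.antisymm _ _ h3 h4
  exact hg (by simpa using this.symm)

end LeftOrdering

/-! ### Rigidity of characters and conclusion. -/

/-- An automorphism sending each element to one commensurable with it by positive powers fixes
every integral character. -/
theorem character_apply_of_pow_eq {G : Type*} [Group G] {φ : MulAut G}
    (hφ : ∀ g, ∃ m n : ℕ, m ≠ 0 ∧ n ≠ 0 ∧ g ^ m = φ g ^ n) (χ : G →* Multiplicative ℤ) (g : G) :
    χ (φ g) = χ g := by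
  have hpos : ∀ x, 0 < (χ x).toAdd ↔ 0 < (χ (φ x)).toAdd := by
    intro x
    obtain ⟨m, n, hm, hn, h⟩ := hφ x
    have := congrArg (fun y => (χ y).toAdd) h
    simp only [map_pow, toAdd_pow, nsmul_eq_mul] at this
    have hm' : (0 : ℤ) < m := by positivity
    have hn' : (0 : ℤ) < n := by positivity
    rw [← mul_pos_iff_of_pos_left hm', this, mul_pos_iff_of_pos_left hn']
  have hzero : ∀ x, (χ x).toAdd = 0 → (χ (φ x)).toAdd = 0 := by
    intro x hx
    have h1 := hpos x
    have h2 := hpos x⁻¹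
    simp only [map_inv, toAdd_inv, hx] at h1 h2
    omega
  by_cases hχ : ∃ x, 0 < (χ x).toAdd
  · have hex : ∃ n : ℕ, 0 < n ∧ ∃ x, (χ x).toAdd = n := by
      obtain ⟨x, hx⟩ := hχ
      exact ⟨(χ x).toAdd.toNat, by omega, x, by omega⟩
    classical
    obtain ⟨hd, t, ht⟩ := Nat.find_spec hex
    -- The positive generator of the image of `χ`.
    set d := Nat.find hex
    have hmin : ∀ x, 0 < (χ x).toAdd → (d : ℤ) ≤ (χ x).toAdd := fun x hx => by
      have := Nat.find_min' hex (m := (χ x).toAdd.toNat) ⟨by omega, x, by omega⟩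
      omega
    have hdvd : ∀ x, ∃ k : ℤ, (χ x).toAdd = k * d ∧ (χ (φ x)).toAdd = k * (χ (φ t)).toAdd := by
      intro x
      have hk : (χ x).toAdd = (χ x).toAdd / d * d := by
        by_contra hne
        have hr := Int.emod_nonneg (χ x).toAdd (b := d) (by omega)
        have hr' := Int.emod_lt_of_pos (χ x).toAdd (b := d) (by omega)
        have he := Int.mul_ediv_add_emod (χ x).toAdd d
        have hx : (χ (x * t ^ (-((χ x).toAdd / d)))).toAdd = (χ x).toAdd % d := by
          simp only [map_mul, map_zpow, toAdd_mul, toAdd_zpow, ht, smul_eq_mul]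
          linarith
        have := hmin (x * t ^ (-((χ x).toAdd / d)))
        rw [hx] at this
        have : (χ x).toAdd % d ≠ 0 := fun h0 => hne (by linarith)
        omega
      refine ⟨_, hk, ?_⟩
      have := hzero (x * t ^ (-((χ x).toAdd / d))) (by
        simp only [map_mul, map_zpow, toAdd_mul, toAdd_zpow, ht, smul_eq_mul]
        linarith)
      simp only [map_mul, map_zpow, toAdd_mul, toAdd_zpow, smul_eq_mul] at this
      linarith
    have hc : (d : ℤ) ≤ (χ (φ t)).toAdd := hmin _ ((hpos t).1 (by omega))
    -- Surjectivity of `φ` gives `d = k * χ (φ t)` with `k > 0`, which with `d ≤ χ (φ t)` forces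
    -- equality.
    obtain ⟨k, hk, hk'⟩ := hdvd (φ⁻¹ t)
    have hk0 : 0 < (χ (φ⁻¹ t)).toAdd := (hpos _).2 (by simp; omega)
    simp only [MulAut.apply_inv_self, ht] at hk'
    have hkpos : 0 < k := by
      rw [hk] at hk0
      exact pos_of_mul_pos_left hk0 (by omega)
    have hcd : (χ (φ t)).toAdd = d := by nlinarith
    obtain ⟨j, hj, hj'⟩ := hdvd g
    apply Multiplicative.toAdd.injective
    rw [hj', hj, hcd]
  · push Not at hχ
    have h0 : ∀ x, χ x = 1 := fun x => by
      have h1 := hχ x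
      have h2 := hχ x⁻¹
      simp only [map_inv, toAdd_inv] at h2
      exact Multiplicative.toAdd.injective (show (χ x).toAdd = 0 by omega)
    rw [h0, h0]

theorem eq_one_of_forall_pullback_eq {G : Type*} [Group G] [Group.FG G]
    (hG : ResiduallyNilpotentUniqueRoots G) {φ : MulAut G}
    (hφ : ∀ o : LeftOrdering G, o.pullback φ = o) : φ = 1 := by
  have := hG.isMulTorsionFree
  have hpow := LeftOrdering.exists_pow_eq_of_pullback_eq hG hφ
  rcases subsingleton_or_nontrivial G with hs | hs
  · ext g
    exact Subsingleton.elim _ _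
  obtain ⟨x, hx⟩ := exists_ne (1 : G)
  -- Only a nonzero character is wanted; the pair `x, 1` merely meets the hypothesis.
  obtain ⟨χ, hχ, -, -⟩ := hG.exists_character x 1 fun m n hm _ h0 =>
    hx (pow_left_injective hm (by simpa using h0))
  have hfix : ∀ g, χ g ≠ 1 → φ g = g := by
    intro g hg
    obtain ⟨m, n, hm, hn, h⟩ := hpow g
    have := congrArg (fun y => (χ y).toAdd) h
    simp only [map_pow, character_apply_of_pow_eq hpow χ g, toAdd_pow, nsmul_eq_mul] at this
    have hg' : (χ g).toAdd ≠ 0 := fun h0 => hg (Multiplicative.toAdd.injective h0)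
    obtain rfl : m = n := by exact_mod_cast mul_right_cancel₀ hg' this
    exact (pow_left_injective hm h).symm
  obtain ⟨t, ht⟩ : ∃ t, χ t ≠ 1 := by
    by_contra! hall
    exact hχ (MonoidHom.ext hall)
  ext g
  by_cases hg : χ g = 1
  -- Both `t` and `t * g` lie outside `ker χ`, hence are fixed.
  · have h1 := hfix (t * g) (by simpa [hg] using ht)
    rw [map_mul, hfix t ht] at h1
    exact mul_left_cancel h1
  · exact hfix g hg

theorem theorem1p1 (G : Type*) [Group G] [Group.FG G]
    (hG : IsResiduallyTorsionFreeNilpotent G) :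
    Function.Injective (LeftOrdering.psiA : MulAut G → (LeftOrdering G ≃ₜ LeftOrdering G)) ∧
      ∀ φ : MulAut G, φ ≠ 1 → ∃ o : LeftOrdering G, LeftOrdering.psiA φ o ≠ o := by
  have hG' := hG.residuallyNilpotentUniqueRoots
  refine ⟨fun φ ψ h => ?_, fun φ hφ => ?_⟩
  · refine mul_inv_eq_one.1 (eq_one_of_forall_pullback_eq hG' fun o => ?_)
    change LeftOrdering.psiA (φ * ψ⁻¹) o = o
    rw [LeftOrdering.psiA_mul, h, ← LeftOrdering.psiA_mul, mul_inv_cancel]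
    rfl
  · by_contra! hall
    exact hφ (eq_one_of_forall_pullback_eq hG' hall)
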